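/- **Setting.** A signature consists of finitely many (at least one) predicate symbols of arities $\ge 0$, finitely many function symbols of arities $\ge 1$, and finitely many (at least one) constants. Formulas are first-order formulas over it, built from $\top,\bot$ and atoms by $\neg,\wedge,\vee,\forall,\exists$. A (formula-based) rule is $A\leftarrow\phi$ with $A$ an atom other than $\top,\bot$ and $\phi$ an arbitrary formula; a program is a finite set of rules. $H_U$ is the set of ground terms, $H_B$ the set of ground atoms other than $\top,\bot$. The truth values are $F_\alpha$, $0$, $T_\alpha$ for countable ordinals $\alpha$, ordered by $$F_0<F_1<\dots<F_\alpha<\dots<0<\dots<T_\alpha<\dots<T_1<T_0 ,$$ with $\deg F_\alpha=\deg T_\alpha=\alpha$ and $\deg 0=\infty$. An interpretation is a map $I$ from $H_B$ to the truth values. It extends to all formulas (under assignments of ground terms to variables) by $\llbracket\top\rrbracket=T_0$, $\llbracket\bot\rrbracket=F_0$, $\min$ for $\wedge$, $\max$ for $\vee$, $\inf$ over $H_U$ for $\forall$, $\sup$ over $H_U$ for $\exists$, and negation $F_\alpha\mapsto T_{\alpha+1}$, $T_\alpha\mapsto F_{\alpha+1}$, $0\mapsto 0$. $I$ is a model of $P$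 if $\llbracket\phi\rrbracket^I_h\le\llbracket A\rrbracket^I_h$ for all rules $A\leftarrow\phi$ of $P$ and all assignments $h$. Put $T_P(I)(A)=\sup\{\llbracket\phi\rrbracket^I:\ A\leftarrow\phi \text{ is a ground instance of a rule of } P\}$, where a ground instance arises by a (capture-free, finitely supported) substitution that makes the head ground and leaves no free variable in the body. For a countable ordinal $\alpha$ write $I=_\alpha J$ if, for all $\beta\le\alpha$, $I$ and $J$ take the value $F_\beta$ at the same atoms and the value $T_\beta$ at the same atoms; $I\sqsubseteq_\alpha J$ if $I=_\beta J$ for all $\beta<\alpha$, $J^{-1}(F_\alpha)\subseteq I^{-1}(F_\alpha)$ and $I^{-1}(T_\alpha)\subseteq J^{-1}(T_\alpha)$; and $I\sqsubseteq_\infty J$ if $I=J$ or there is a countable $\alpha$ with $I\sqsubseteq_\alpha J$ and not $I=_\alpha J$. **The model $M_P$ and the depth $\delta_P$.** For interpretations $I$ with $I\sqsubseteq_\alpha T_P(I)$ let $T^0_{P,\alpha}(I)=I$, $T^{\beta+1}_{P,\alpha}(I)=T_P(T^{\beta}_{P,\alpha}(I))$, and for limit $\beta>0$ let $T^\beta_{P,\alpha}(I)(A)$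 be $I(A)$ if $\deg I(A)<\alpha$; $T_\alpha$ if $T^\gamma_{P,\alpha}(I)(A)=T_\alpha$ for some $\gamma<\beta$; $F_\alpha$ if $T^\gamma_{P,\alpha}(I)(A)=F_\alpha$ for all $\gamma<\beta$; and $F_{\alpha+1}$ otherwise. By recursion on countable $\alpha$ put $M_\alpha=T^{\aleph_1}_{P,\alpha}(J_\alpha)$, where $J_\alpha(A)=M_\zeta(A)$ if $\zeta<\alpha$ and $M_\zeta(A)\in\{F_\zeta,T_\zeta\}$, and $J_\alpha(A)=F_\alpha$ if there is no such $\zeta$ (if the $M_\gamma$, $\gamma<\alpha$, do not satisfy $M_\zeta=_\zeta M_\gamma$ for $\zeta<\gamma<\alpha$, or if $J_\alpha\sqsubseteq_\alpha T_P(J_\alpha)$ fails, $M_\alpha$ is set constantly $F_0$). The depth $\delta_P$ is the least countable ordinal $\delta$ such that for all countable $\gamma\ge\delta$ the interpretation $M_\gamma$ takes neither the value $F_\gamma$ nor $T_\gamma$. Finally $M_P(A)=M_{\delta_P}(A)$ if $\deg M_{\delta_P}(A)<\delta_P$, and $M_P(A)=0$ otherwise. Let $\delta_{\max}$ be the least countable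 ordinal $\delta$ such that $\delta_P<\delta$ for all programs $P$ over all signatures. **Proposition 4.** $\delta_{\max}\ge\omega^\omega$. This is witnessed by the following programs $P_n$, $n\ge1$, over the signature with an $n$-ary predicate symbol $G$, a $0$-ary predicate symbol $H$, a unary function symbol $f$ and a constant $c$: * $G(x_1,\dots,x_{n-1},f(x_n))\leftarrow\neg\neg G(x_1,\dots,x_n)$; * $G(x_1,\dots,x_{k-1},f(x_k),c,\dots,c)\leftarrow\exists x_{k+1}\cdots\exists x_n\,G(x_1,\dots,x_n)$ for $1\le k\le n-1$; * $H\leftarrow\exists x_1\cdots\exists x_n\,G(x_1,\dots,x_n)$. For every $n\ge1$: $M_{P_n}$ is a model of $P_n$ and satisfies $M_{P_n}\sqsubseteq_\infty M$ for every model $M$ of $P_n$; $M_{P_n}(H)=F_{\omega^n}$; for all $k_1,\dots,k_n\in\mathbb N$, $$M_{P_n}\bigl(G(f^{k_1}(c),\dots,f^{k_n}(c))\bigr)=F_{\omega^{n-1}\cdot k_1+\omega^{n-2}\cdot k_2+\dots+\omega\cdot k_{n-1}+2\cdot k_n}$$ (standard ordinal arithmetic, the sum taken from left to right); and hence $\delta_{P_n}>\omega^n$.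 -/

import Mathlib

open scoped Ordinal

namespace FormulaLP

/-! ### First-order languages, terms and formulas -/

/-- A signature: at least one predicate symbol, finitely many function symbols of positive arity,
at least one constant. -/
structure Signature where
  numPred : ℕ
  numFun : ℕ
  numConst : ℕ
  predArity : Fin numPred → ℕ
  funArity : Fin numFun → ℕ
  numPred_pos : 1 ≤ numPred
  numConst_pos : 1 ≤ numConst
  funArity_pos : ∀ i, 1 ≤ funArity i

/-- Terms of the signature `L` with variables from `V`. -/
inductive Term (L : Signature) (V : Type) : Type
  | var (x : V) : Term L V
  | const (c : Fin L.numConst) : Term L V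
  | func (i : Fin L.numFun) (ts : Fin (L.funArity i) → Term L V) : Term L V

namespace Term

variable {L : Signature} {V U : Type}

/-- Simultaneous replacement of the variables of a term by terms. -/
def subst (s : V → Term L U) : Term L V → Term L U
  | var x => s x
  | const c => const c
  | func i ts => func i (fun j => (ts j).subst s)

/-- The set of variables of a term. -/
def vars : Term L V → Set V
  | var x => {x}
  | const _ => ∅
  | func _ ts => ⋃ j, (ts j).vars

end Term

/-- The Herbrand universe: terms without variables. -/
abbrev HerbrandUniverse (L : Signature) : Type := Term L Empty

/-- A ground term, viewed as a term over the variables `x_0, x_1, …`. -/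
def HerbrandUniverse.toTerm {L : Signature} (u : HerbrandUniverse L) : Term L ℕ :=
  Term.subst Empty.elim u

/-- First-order formulas; the variables are the natural numbers. -/
inductive Formula (L : Signature) : Type
  | bot : Formula L
  | top : Formula L
  | pred (k : Fin L.numPred) (ts : Fin (L.predArity k) → Term L ℕ) : Formula L
  | neg (p : Formula L) : Formula L
  | and (p q : Formula L) : Formula L
  | or (p q : Formula L) : Formula L
  | all (v : ℕ) (p : Formula L) : Formula L
  | ex (v : ℕ) (p : Formula L) : Formula L

namespace Formula

variable {L : Signature}

/-- The set of variables with a free occurrence. -/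
def freeVars : Formula L → Set ℕ
  | bot => ∅
  | top => ∅
  | pred _ ts => ⋃ j, (ts j).vars
  | neg p => p.freeVars
  | and p q => p.freeVars ∪ q.freeVars
  | or p q => p.freeVars ∪ q.freeVars
  | all v p => p.freeVars \ {v}
  | ex v p => p.freeVars \ {v}

/-- Replacement of the free occurrences of variables. -/
def subst : Formula L → (ℕ → Term L ℕ) → Formula L
  | bot, _ => bot
  | top, _ => top
  | pred k ts, s => pred k (fun j => (ts j).subst s)
  | neg p, s => neg (p.subst s)
  | and p q, s => and (p.subst s) (q.subst s)
  | or p q, s => or (p.subst s) (q.subst s)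
  | all v p, s => all v (p.subst (Function.update s v (Term.var v)))
  | ex v p, s => ex v (p.subst (Function.update s v (Term.var v)))

/-- The substitution `s` is free for the formula: no variable of a substituted term is captured
by a quantifier. -/
def FreeFor : Formula L → (ℕ → Term L ℕ) → Prop
  | bot, _ => True
  | top, _ => True
  | pred _ _, _ => True
  | neg p, s => p.FreeFor s
  | and p q, s => p.FreeFor s ∧ q.FreeFor s
  | or p q, s => p.FreeFor s ∧ q.FreeFor s
  | all v p, s => p.FreeFor (Function.update s v (Term.var v)) ∧
      ∀ x ∈ p.freeVars \ {v}, v ∉ (s x).vars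
  | ex v p, s => p.FreeFor (Function.update s v (Term.var v)) ∧
      ∀ x ∈ p.freeVars \ {v}, v ∉ (s x).vars

/-- `∃ v₁, …, v_r φ`. -/
def exs (vs : List ℕ) (p : Formula L) : Formula L := vs.foldr Formula.ex p

end Formula

/-- The Herbrand base: ground atoms other than `⊥` and `⊤`. -/
structure GroundAtom (L : Signature) : Type where
  pred : Fin L.numPred
  args : Fin (L.predArity pred) → HerbrandUniverse L

/-- A rule `P_k(t_1, …, t_r) ← φ`. -/
structure Rule (L : Signature) : Type where
  pred : Fin L.numPred
  args : Fin (L.predArity pred) → Term L ℕ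
  body : Formula L

/-- A formula-based logic program: a finite set of rules. -/
structure Program (L : Signature) : Type where
  rules : Set (Rule L)
  finite : rules.Finite

/-! ### Truth values -/

/-- The countable ordinals, that is, the elements of `ℵ₁`. -/
abbrev CountableOrdinal : Type 1 := {o : Ordinal.{0} // o < ω₁}

theorem add_one_lt_omega_one {o : Ordinal.{0}} (h : o < ω₁) : o + 1 < ω₁ :=
  (Cardinal.isSuccLimit_omega 1).add_one_lt h

/-- The successor of a countable ordinal. -/
noncomputable def CountableOrdinal.next (a : CountableOrdinal) : CountableOrdinal :=
  ⟨a.1 + 1, add_one_lt_omega_one a.2⟩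

/-- The truth values `F_α`, `0`, `T_α` for countable ordinals `α`. -/
inductive TruthValue : Type 1
  | F (a : CountableOrdinal) : TruthValue
  | zero : TruthValue
  | T (a : CountableOrdinal) : TruthValue

namespace TruthValue

/-- `F_0 < F_1 < … < 0 < … < T_1 < T_0`. -/
protected def le : TruthValue → TruthValue → Prop
  | F a, F b => a ≤ b
  | F _, zero => True
  | F _, T _ => True
  | zero, F _ => False
  | zero, zero => True
  | zero, T _ => True
  | T _, F _ => False
  | T _, zero => False
  | T a, T b => b ≤ a

noncomputable instance : LinearOrder TruthValue where
  le := TruthValue.le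
  le_refl a := by cases a <;> simp [TruthValue.le]
  le_trans a b c := by
    cases a <;> cases b <;> cases c <;> simp only [TruthValue.le] <;> try tauto
    · exact le_trans
    · exact fun h h' => le_trans h' h
  le_antisymm a b := by
    cases a <;> cases b <;> simp only [TruthValue.le] <;> try tauto
    · exact fun h h' => by rw [le_antisymm h h']
    · exact fun h h' => by rw [le_antisymm h' h]
  le_total a b := by
    cases a <;> cases b <;> simp only [TruthValue.le] <;> try tauto
    · exact le_total _ _
    · exact le_total _ _
  toDecidableLE := Classical.decRel _

theorem le_iff (v w : TruthValue) : v ≤ w ↔ TruthValue.le v w := Iff.rfl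

theorem exists_isLUB (s : Set TruthValue) : ∃ w, IsLUB s w := by
  by_cases hT : ∃ a, T a ∈ s
  · let S : Set CountableOrdinal := {a | T a ∈ s}
    have hS : S.Nonempty := hT
    refine ⟨T (wellFounded_lt.min S hS), ?_, fun w hw => hw (wellFounded_lt.min_mem S hS)⟩
    intro v hv
    cases v with
    | F a => trivial
    | zero => trivial
    | T a => exact wellFounded_lt.min_le (s := S) hv
  · have hle : ∀ v ∈ s, v ≤ zero := by
      intro v hv
      cases v with
      | F a => trivial
      | zero => trivial
      | T a => exact absurd ⟨a, hv⟩ hT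
    let S : Set CountableOrdinal := {a | ∀ v ∈ s, v ≤ F a}
    by_cases hS : S.Nonempty
    · refine ⟨F (wellFounded_lt.min S hS), wellFounded_lt.min_mem S hS, ?_⟩
      intro w hw
      cases w with
      | F a => exact wellFounded_lt.min_le (s := S) (fun v hv => hw hv)
      | zero => trivial
      | T a => trivial
    · refine ⟨zero, hle, ?_⟩
      intro w hw
      cases w with
      | F a => exact absurd ⟨a, fun v hv => hw hv⟩ hS
      | zero => trivial
      | T a => trivial

theorem exists_isGLB (s : Set TruthValue) : ∃ w, IsGLB s w := by
  obtain ⟨w, hw⟩ := exists_isLUB (lowerBounds s)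
  exact ⟨w, isLUB_lowerBounds.1 hw⟩

/-- The least upper bound of a set of truth values. -/
noncomputable def sup (s : Set TruthValue) : TruthValue := (exists_isLUB s).choose

theorem isLUB_sup (s : Set TruthValue) : IsLUB s (sup s) := (exists_isLUB s).choose_spec

/-- The greatest lower bound of a set of truth values. -/
noncomputable def inf (s : Set TruthValue) : TruthValue := (exists_isGLB s).choose

theorem isGLB_inf (s : Set TruthValue) : IsGLB s (inf s) := (exists_isGLB s).choose_spec

/-- The degree: `deg F_α = deg T_α = α` and `deg 0 = ∞`. -/
def deg : TruthValue → WithTop CountableOrdinal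
  | F a => a
  | zero => ⊤
  | T a => a

/-- The value of a negation. -/
noncomputable def neg : TruthValue → TruthValue
  | F a => T a.next
  | zero => zero
  | T a => F a.next

end TruthValue

open TruthValue

/-! ### Interpretations, models, the orderings -/

/-- An infinite-valued Herbrand interpretation. -/
abbrev Interpretation (L : Signature) : Type 1 := GroundAtom L → TruthValue

/-- A variable assignment. -/
abbrev Assignment (L : Signature) : Type := ℕ → HerbrandUniverse L

/-- The semantics of formulas (the value of a term `t` under `h` is `t.subst h`). -/
noncomputable def Formula.eval {L : Signature} (I : Interpretation L) :
    Formula L → Assignment L → TruthValue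
  | bot, _ => F ⟨0, Ordinal.omega_pos 1⟩
  | top, _ => T ⟨0, Ordinal.omega_pos 1⟩
  | pred k ts, h => I ⟨k, fun j => (ts j).subst h⟩
  | neg p, h => (p.eval I h).neg
  | and p q, h => min (p.eval I h) (q.eval I h)
  | or p q, h => max (p.eval I h) (q.eval I h)
  | all v p, h => inf (Set.range fun u : HerbrandUniverse L => p.eval I (Function.update h v u))
  | ex v p, h => sup (Set.range fun u : HerbrandUniverse L => p.eval I (Function.update h v u))

/-- The value of a formula without free variables: the assignment does not matter, so a constant
one is taken. -/
noncomputable def Formula.value {L : Signature} (I : Interpretation L) (p : Formula L) :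
    TruthValue :=
  p.eval I (fun _ => Term.const ⟨0, L.numConst_pos⟩)

/-- `I` satisfies the rule `r`. -/
def Interpretation.Satisfies {L : Signature} (I : Interpretation L) (r : Rule L) : Prop :=
  ∀ h : Assignment L, r.body.eval I h ≤ (Formula.pred r.pred r.args).eval I h

/-- `I` is a model of the program `P`. -/
def Interpretation.IsModel {L : Signature} (I : Interpretation L) (P : Program L) : Prop :=
  ∀ r ∈ P.rules, I.Satisfies r

/-- The set of ground atoms that have the value `w` under `I`. -/
def Interpretation.fiber {L : Signature} (I : Interpretation L) (w : TruthValue) :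
    Set (GroundAtom L) :=
  {A | I A = w}

/-- `I =_α J`. -/
def EqUpTo {L : Signature} (a : CountableOrdinal) (I J : Interpretation L) : Prop :=
  ∀ b ≤ a, I.fiber (F b) = J.fiber (F b) ∧ I.fiber (T b) = J.fiber (T b)

/-- `I ⊑_α J`. -/
def LEAt {L : Signature} (a : CountableOrdinal) (I J : Interpretation L) : Prop :=
  (∀ b < a, EqUpTo b I J) ∧ J.fiber (F a) ⊆ I.fiber (F a) ∧ I.fiber (T a) ⊆ J.fiber (T a)

/-- `I ⊏_α J`. -/
def LTAt {L : Signature} (a : CountableOrdinal) (I J : Interpretation L) : Prop :=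
  LEAt a I J ∧ ¬ EqUpTo a I J

/-- `I ⊑_∞ J`. -/
def LEInfty {L : Signature} (I J : Interpretation L) : Prop :=
  (∃ a, LTAt a I J) ∨ I = J

/-- `I` is a model of `P`, and the least one with respect to `⊑_∞`. -/
def Interpretation.IsLeastModel {L : Signature} (I : Interpretation L) (P : Program L) : Prop :=
  I.IsModel P ∧ ∀ J : Interpretation L, J.IsModel P → LEInfty I J

/-! ### The immediate consequence operator and the construction of the model `M_P` -/

/-- The rule `rσ`. -/
def Rule.subst {L : Signature} (r : Rule L) (s : ℕ → Term L ℕ) : Rule L :=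
  ⟨r.pred, fun j => (r.args j).subst s, r.body.subst s⟩

/-- The ground instances `rσ` of the rules of `P`: the substitution has finite support, the head of
`rσ` is a ground atom, and the body of `rσ` has no free variable. -/
def Program.groundInstances {L : Signature} (P : Program L) : Set (Rule L) :=
  {r' | ∃ r ∈ P.rules, ∃ s : ℕ → Term L ℕ,
    {x | s x ≠ Term.var x}.Finite ∧ r.body.FreeFor s ∧ r' = r.subst s ∧
    (∀ j, (r'.args j).vars = ∅) ∧ r'.body.freeVars = ∅}

/-- The immediate consequence operator. -/
noncomputable def Program.consequence {L : Signature} (P : Program L) (I : Interpretation L) :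
    Interpretation L :=
  fun A => sup {w | ∃ p : Formula L,
    (⟨A.pred, fun j => (A.args j).toTerm, p⟩ : Rule L) ∈ P.groundInstances ∧ w = p.value I}

open Classical in
/-- The iteration `T_{P,α}^β(I)`. -/
noncomputable def Program.iterate {L : Signature} (P : Program L) (a : CountableOrdinal)
    (I : Interpretation L) (b : Ordinal.{0}) : Interpretation L :=
  Ordinal.limitRecOn b I (fun _ J => P.consequence J)
    (fun b _ J A =>
      if (I A).deg < a then I A
      else if ∃ c, ∃ h : c < b, A ∈ (J c h).fiber (T a) then T a
      else if ∀ c, ∀ h : c < b, A ∈ (J c h).fiber (F a) then F a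
      else F a.next)

open Classical in
/-- The union of the interpretations `I_γ`, `γ < α`: where some `I_ζ` with `ζ < α` takes the value
`F_ζ` or `T_ζ`, the union has this value; elsewhere it has the value `F_α`. -/
noncomputable def union {L : Signature} (a : CountableOrdinal)
    (I : ∀ c : CountableOrdinal, c < a → Interpretation L) : Interpretation L :=
  fun A =>
    if h : ∃ z, ∃ hz : z < a, I z hz A = F z ∨ I z hz A = T z then I h.choose h.choose_spec.1 A
    else F a

open Classical in
/-- The recursion step for the approximants: `M_α` in terms of the `M_γ` with `γ < α`. -/
noncomputable def Program.approximantStep {L : Signature} (P : Program L) (a : CountableOrdinal)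
    (M : ∀ c : CountableOrdinal, c < a → Interpretation L) : Interpretation L :=
  if (∀ c, ∀ hc : c < a, ∀ z, ∀ hz : z < c, EqUpTo z (M z (hz.trans hc)) (M c hc)) ∧
      LEAt a (union a M) (P.consequence (union a M)) then
    P.iterate a (union a M) ω₁
  else fun _ => F ⟨0, Ordinal.omega_pos 1⟩

/-- The approximant `M_α` of `P`. -/
noncomputable def Program.approximant {L : Signature} (P : Program L) :
    CountableOrdinal → Interpretation L :=
  (wellFounded_lt : WellFounded ((· < ·) : CountableOrdinal → CountableOrdinal → Prop)).fix
    P.approximantStep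

theorem Program.approximant_eq {L : Signature} (P : Program L) (a : CountableOrdinal) :
    P.approximant a = P.approximantStep a (fun c _ => P.approximant c) :=
  WellFounded.fix_eq _ _ _

/-- The set of countable ordinals `δ` such that, for all countable `γ ≥ δ`, the approximant `M_γ`
takes neither the value `F_γ` nor the value `T_γ`. -/
def Program.depthSet {L : Signature} (P : Program L) : Set Ordinal.{0} :=
  {d | d < ω₁ ∧ ∀ c : CountableOrdinal, d ≤ c.1 →
    (P.approximant c).fiber (F c) = ∅ ∧ (P.approximant c).fiber (T c) = ∅}

theorem Program.sInf_depthSet_lt {L : Signature} (P : Program L) : sInf P.depthSet < ω₁ := by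
  by_cases h : P.depthSet.Nonempty
  · exact (csInf_mem h).1
  · rw [Set.not_nonempty_iff_eq_empty.1 h, Ordinal.sInf_empty]
    exact Ordinal.omega_pos 1

/-- The depth `δ_P` of the program `P`. -/
noncomputable def Program.depth {L : Signature} (P : Program L) : CountableOrdinal :=
  ⟨sInf P.depthSet, P.sInf_depthSet_lt⟩

open Classical in
/-- The interpretation `M_P`. -/
noncomputable def Program.model {L : Signature} (P : Program L) : Interpretation L :=
  fun A => if (P.approximant P.depth A).deg < P.depth then P.approximant P.depth A else zero

/-- `δ_max`: the least countable ordinal that exceeds the depth of every program over every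
signature. -/
noncomputable def deltaMax : Ordinal.{0} :=
  sInf {d | d < ω₁ ∧ ∀ (L : Signature) (P : Program L), P.depth.1 < d}

/-! ### The programs `P_n`, for `n = N + 1` -/

/-- Predicate symbols `G` (index `0`, arity `N + 1`) and `H` (index `1`, arity `0`), one unary
function symbol `f`, one constant `c`. -/
abbrev exSignature (N : ℕ) : Signature where
  numPred := 2
  numFun := 1
  numConst := 1
  predArity := ![N + 1, 0]
  funArity := fun _ => 1
  numPred_pos := by norm_num
  numConst_pos := le_rfl
  funArity_pos := fun _ => le_rfl

section Example

variable {N : ℕ} {V : Type}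

/-- The constant `c`. -/
def cTerm : Term (exSignature N) V := Term.const 0

/-- The term `f(t)`. -/
def fTerm (t : Term (exSignature N) V) : Term (exSignature N) V := Term.func 0 (fun _ => t)

/-- The formula `G(x_0, …, x_N)`. -/
def gVars (N : ℕ) : Formula (exSignature N) :=
  Formula.pred 0 (fun i : Fin (N + 1) => Term.var (i : ℕ))

/-- `G(x_0, …, x_{N-1}, f(x_N)) ← ¬¬G(x_0, …, x_N)`. -/
def lastRule (N : ℕ) : Rule (exSignature N) where
  pred := 0
  args := fun i : Fin (N + 1) => if i = Fin.last N then fTerm (Term.var (i : ℕ)) else Term.var (i : ℕ)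
  body := Formula.neg (Formula.neg (gVars N))

/-- `G(x_0, …, x_{k-1}, f(x_k), c, …, c) ← ∃ x_{k+1}, …, x_N G(x_0, …, x_N)`, for `k < N`. -/
def limitRule (N : ℕ) (k : Fin N) : Rule (exSignature N) where
  pred := 0
  args := fun i : Fin (N + 1) =>
    if (i : ℕ) < k then Term.var (i : ℕ)
    else if (i : ℕ) = k then fTerm (Term.var (i : ℕ))
    else cTerm
  body := Formula.exs (List.range' (k + 1) (N - k)) (gVars N)

/-- `H ← ∃ x_0, …, x_N G(x_0, …, x_N)`. -/
def hRule (N : ℕ) : Rule (exSignature N) where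
  pred := 1
  args := fun i : Fin 0 => i.elim0
  body := Formula.exs (List.range (N + 1)) (gVars N)

/-- The program `P_{N+1}`. -/
def exProgram (N : ℕ) : Program (exSignature N) where
  rules := {lastRule N, hRule N} ∪ Set.range (limitRule N)
  finite := (Set.toFinite _).union (Set.finite_range _)

/-- The ground term `f^k(c)`. -/
def fPow (N k : ℕ) : HerbrandUniverse (exSignature N) := fTerm^[k] cTerm

/-- The ground atom `G(f^{k_0}(c), …, f^{k_N}(c))`. -/
def gAtom (N : ℕ) (k : Fin (N + 1) → ℕ) : GroundAtom (exSignature N) :=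
  ⟨0, fun i : Fin (N + 1) => fPow N (k i)⟩

/-- The ground atom `H`. -/
def hAtom (N : ℕ) : GroundAtom (exSignature N) := ⟨1, fun i : Fin 0 => i.elim0⟩

/-- The ordinal `ω^N·k_0 + ω^(N-1)·k_1 + … + ω^1·k_{N-1} + 2·k_N`, the summands being added from
left to right. -/
noncomputable def gOrdinal (N : ℕ) (k : Fin (N + 1) → ℕ) : Ordinal.{0} :=
  (List.ofFn fun m : Fin N => ω ^ (N - (m : ℕ)) * (k m.castSucc : Ordinal.{0})).sum +
    ((2 * k (Fin.last N) : ℕ) : Ordinal.{0})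

end Example

end FormulaLP

/-!
The proof rests on one observation: the program `P_n` generates its atoms along an ordinal rank
`e`, namely `e (G(f^{k_1}(c), …, f^{k_n}(c))) = ω^{n-1}·k_1 + … + ω·k_{n-1} + 2·k_n` and
`e H = ω^n`. The atom `G(c, …, c)` is the head of no rule instance; the rule with a double negation
raises the rank by two; each rule with existential quantifiers produces an atom whose rank is the
supremum of the ranks of its premises. So `A ↦ F_{e A}` is a fixed point of the (monotone)
consequence operator.

That is all that is needed (`Program.IsRanked`). Let `truncate e x` be `A ↦ F_{min (e A) x}`. Then
`truncate e x` lies below its image under the consequence operator, and applying the operator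
twice leads above `truncate e (x + 1)` (`truncate_next_le_consequence`), because a supremum above
`x` has a premise of rank above `x` that comes from a double negation, which is settled in one step.

* The interpretation `J_α` from which the approximant `M_α` is iterated is `truncate e α`. From the
  second stage on, the iteration is caught between `truncate e (α + 1)` and `A ↦ F_{e A}`
  (`iterate_bounds`), so `M_α` takes the value `F_α` exactly at the atoms of rank `α`. Hence the
  depth exceeds all ranks and `M_P` is `A ↦ F_{e A}` (`model_eq`).
* If a model `J` agrees with `A ↦ F_{e A}` below `α`, then `J` lies above `truncate e α`, and being
  a pre-fixed point of the operator also above `truncate e (α + 1)`. So the atoms with value `F_α`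
  in `J` have rank `α`, which is minimality (`isLeastModel`).

The consequence operator is defined by syntactic ground instances; `consequence_le_iff` replaces
them by assignments. The bound on `deltaMax` follows from the depths of the `P_n`, once there is
a countable ordinal above all depths: there are only countably many programs, and `ω₁` is regular.
-/

namespace FormulaLP

open TruthValue

/-! ### Substitution and the immediate consequence operator -/

namespace Term

variable {L : Signature} {V U W : Type}

theorem subst_subst (s : V → Term L U) (s' : U → Term L W) (t : Term L V) :
    (t.subst s).subst s' = t.subst fun x => (s x).subst s' := by
  induction t with
  | var x => rfl
  | const c => rfl
  | func i ts ih => simp only [subst, ih]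

theorem subst_congr {s s' : V → Term L U} {t : Term L V} (h : ∀ x ∈ t.vars, s x = s' x) :
    t.subst s = t.subst s' := by
  induction t with
  | var x => exact h x rfl
  | const c => rfl
  | func i ts ih =>
    simp only [subst]
    congr 1
    exact funext fun j => ih j fun x hx => h x (Set.mem_iUnion.2 ⟨j, hx⟩)

theorem subst_of_isEmpty {s : Empty → Term L Empty} (t : Term L Empty) : t.subst s = t := by
  induction t with
  | var x => exact x.elim
  | const c => rfl
  | func i ts ih => simp only [subst, ih]

theorem vars_subst (s : V → Term L U) (t : Term L V) :
    (t.subst s).vars = ⋃ x ∈ t.vars, (s x).vars := by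
  induction t with
  | var x => simp [subst, vars]
  | const c => simp [subst, vars]
  | func i ts ih =>
    ext y
    simp only [subst, vars, ih, Set.mem_iUnion]
    constructor
    · rintro ⟨j, x, hx, hy⟩
      exact ⟨x, ⟨j, hx⟩, hy⟩
    · rintro ⟨x, ⟨j, hx⟩, hy⟩
      exact ⟨j, x, hx, hy⟩

theorem finite_vars (t : Term L V) : t.vars.Finite := by
  induction t with
  | var x => exact Set.finite_singleton x
  | const c => exact Set.finite_empty
  | func i ts ih => exact Set.finite_iUnion ih

end Term

namespace HerbrandUniverse

variable {L : Signature}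

theorem vars_toTerm (u : HerbrandUniverse L) : u.toTerm.vars = ∅ := by
  rw [toTerm, Term.vars_subst]
  exact Set.iUnion_eq_empty.2 fun x => x.elim

theorem subst_toTerm (u : HerbrandUniverse L) (h : Assignment L) : u.toTerm.subst h = u := by
  rw [toTerm, Term.subst_subst, Term.subst_of_isEmpty]

end HerbrandUniverse

namespace Formula

variable {L : Signature}

theorem finite_freeVars (p : Formula L) : p.freeVars.Finite := by
  induction p with
  | bot => exact Set.finite_empty
  | top => exact Set.finite_empty
  | pred k ts => exact Set.finite_iUnion fun j => (ts j).finite_vars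
  | neg p ih => exact ih
  | and p q hp hq => exact hp.union hq
  | or p q hp hq => exact hp.union hq
  | all v p ih => exact ih.subset Set.sdiff_subset
  | ex v p ih => exact ih.subset Set.sdiff_subset

theorem eval_congr (I : Interpretation L) {p : Formula L} {h h' : Assignment L}
    (hh : ∀ x ∈ p.freeVars, h x = h' x) : p.eval I h = p.eval I h' := by
  have key : ∀ (p : Formula L) (v : ℕ) (h h' : Assignment L) (u : HerbrandUniverse L),
      (∀ x ∈ p.freeVars \ {v}, h x = h' x) →
      ∀ x ∈ p.freeVars, Function.update h v u x = Function.update h' v u x := by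
    intro p v h h' u hh x hx
    rcases eq_or_ne x v with rfl | hxv
    · simp
    · simpa [hxv] using hh x ⟨hx, hxv⟩
  induction p generalizing h h' with
  | bot => rfl
  | top => rfl
  | pred k ts =>
    simp only [eval]
    congr 2
    exact funext fun j => Term.subst_congr fun x hx => hh x (Set.mem_iUnion.2 ⟨j, hx⟩)
  | neg p ih => simp only [eval, ih hh]
  | and p q hp hq =>
    simp only [eval, hp fun x hx => hh x (Or.inl hx), hq fun x hx => hh x (Or.inr hx)]
  | or p q hp hq =>
    simp only [eval, hp fun x hx => hh x (Or.inl hx), hq fun x hx => hh x (Or.inr hx)]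
  | all v p ih => simp only [eval, ih (key p v h h' _ hh)]
  | ex v p ih => simp only [eval, ih (key p v h h' _ hh)]

/-- The substitution lemma. -/
theorem eval_subst (I : Interpretation L) {p : Formula L} {s : ℕ → Term L ℕ} (hs : p.FreeFor s)
    (h : Assignment L) : (p.subst s).eval I h = p.eval I fun x => (s x).subst h := by
  have key : ∀ (p : Formula L) (v : ℕ) (s : ℕ → Term L ℕ) (h : Assignment L)
      (u : HerbrandUniverse L), (∀ x ∈ p.freeVars \ {v}, v ∉ (s x).vars) →
      p.eval I (fun x => (Function.update s v (Term.var v) x).subst (Function.update h v u)) =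
        p.eval I (Function.update (fun x => (s x).subst h) v u) := by
    intro p v s h u hs
    refine eval_congr I fun x hx => ?_
    rcases eq_or_ne x v with rfl | hxv
    · simp [Term.subst]
    · simp only [Function.update_of_ne hxv]
      refine Term.subst_congr fun y hy => Function.update_of_ne ?_ _ _
      rintro rfl
      exact hs x ⟨hx, hxv⟩ hy
  induction p generalizing s h with
  | bot => rfl
  | top => rfl
  | pred k ts => simp only [subst, eval, Term.subst_subst]
  | neg p ih => simp only [subst, eval, ih hs]
  | and p q hp hq => simp only [subst, eval, hp hs.1, hq hs.2]
  | or p q hp hq => simp only [subst, eval, hp hs.1, hq hs.2]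
  | all v p ih => simp only [subst, eval, ih hs.1, key p v s h _ hs.2]
  | ex v p ih => simp only [subst, eval, ih hs.1, key p v s h _ hs.2]

theorem freeFor_of_vars_eq_empty {p : Formula L} {s : ℕ → Term L ℕ}
    (hs : ∀ x, (s x).vars = ∅ ∨ s x = Term.var x) : p.FreeFor s := by
  have upd : ∀ (v : ℕ) (s : ℕ → Term L ℕ), (∀ x, (s x).vars = ∅ ∨ s x = Term.var x) →
      ∀ x, (Function.update s v (Term.var v) x).vars = ∅ ∨
        Function.update s v (Term.var v) x = Term.var x := by
    intro v s hs x
    rcases eq_or_ne x v with rfl | hxv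
    · simp
    · simpa [hxv] using hs x
  have cap : ∀ (v : ℕ) (s : ℕ → Term L ℕ), (∀ x, (s x).vars = ∅ ∨ s x = Term.var x) →
      ∀ x, x ≠ v → v ∉ (s x).vars := by
    intro v s hs x hx hv
    rcases hs x with h | h
    · simp [h] at hv
    · rw [h] at hv
      exact hx hv.symm
  induction p generalizing s with
  | bot => trivial
  | top => trivial
  | pred k ts => trivial
  | neg p ih => exact ih hs
  | and p q hp hq => exact ⟨hp hs, hq hs⟩
  | or p q hp hq => exact ⟨hp hs, hq hs⟩
  | all v p ih => exact ⟨ih (upd v s hs), fun x hx => cap v s hs x hx.2⟩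
  | ex v p ih => exact ⟨ih (upd v s hs), fun x hx => cap v s hs x hx.2⟩

theorem freeVars_subst_eq_empty {p : Formula L} {s : ℕ → Term L ℕ}
    (hs : ∀ x ∈ p.freeVars, (s x).vars = ∅) : (p.subst s).freeVars = ∅ := by
  suffices H : ∀ (p : Formula L) (s : ℕ → Term L ℕ),
      (p.subst s).freeVars ⊆ ⋃ x ∈ p.freeVars, (s x).vars by
    refine Set.subset_empty_iff.1 ((H p s).trans ?_)
    simp only [Set.iUnion_subset_iff]
    exact fun x hx => (hs x hx).subset
  have upd : ∀ (p : Formula L) (v : ℕ) (s : ℕ → Term L ℕ),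
      (⋃ x ∈ p.freeVars, (Function.update s v (Term.var v) x).vars) \ {v} ⊆
        ⋃ x ∈ p.freeVars \ {v}, (s x).vars := by
    rintro p v s y ⟨hy, hyv⟩
    simp only [Set.mem_iUnion] at hy ⊢
    obtain ⟨x, hx, hy⟩ := hy
    rcases eq_or_ne x v with rfl | hxv
    · simp only [Function.update_self] at hy
      exact absurd hy hyv
    · rw [Function.update_of_ne hxv] at hy
      exact ⟨x, ⟨hx, hxv⟩, hy⟩
  intro p
  induction p with
  | bot => intro s; exact Set.empty_subset _
  | top => intro s; exact Set.empty_subset _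
  | pred k ts =>
    intro s y hy
    simp only [subst, freeVars, Term.vars_subst, Set.mem_iUnion] at hy ⊢
    obtain ⟨j, x, hx, hy⟩ := hy
    exact ⟨x, ⟨j, hx⟩, hy⟩
  | neg p ih => exact ih
  | and p q hp hq =>
    intro s
    refine Set.union_subset ((hp s).trans ?_) ((hq s).trans ?_)
    · exact Set.biUnion_subset_biUnion_left Set.subset_union_left
    · exact Set.biUnion_subset_biUnion_left Set.subset_union_right
  | or p q hp hq =>
    intro s
    refine Set.union_subset ((hp s).trans ?_) ((hq s).trans ?_)
    · exact Set.biUnion_subset_biUnion_left Set.subset_union_left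
    · exact Set.biUnion_subset_biUnion_left Set.subset_union_right
  | all v p ih => exact fun s => (Set.sdiff_subset_sdiff_left (ih _)).trans (upd p v s)
  | ex v p ih => exact fun s => (Set.sdiff_subset_sdiff_left (ih _)).trans (upd p v s)

/-- A block of existential quantifiers takes the supremum over all assignments that differ from
the given one only at the quantified variables. -/
theorem eval_exs_le_iff (I : Interpretation L) (vs : List ℕ) (p : Formula L) (h : Assignment L)
    (w : TruthValue) : (exs vs p).eval I h ≤ w ↔
      ∀ h' : Assignment L, (∀ x, x ∉ vs → h' x = h x) → p.eval I h' ≤ w := by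
  induction vs generalizing h with
  | nil =>
    constructor
    · intro H h' hh'
      rwa [show h' = h from funext fun x => hh' x (by simp)]
    · exact fun H => H h fun _ _ => rfl
  | cons v vs ih =>
    change sup (Set.range fun u => (exs vs p).eval I (Function.update h v u)) ≤ w ↔ _
    rw [isLUB_le_iff (isLUB_sup _)]
    simp only [mem_upperBounds, Set.forall_mem_range, ih]
    constructor
    · intro H h' hh'
      refine H (h' v) h' fun x hx => ?_
      rcases eq_or_ne x v with rfl | hxv
      · simp
      · rw [Function.update_of_ne hxv, hh' x (by simp [hxv, hx])]
    · intro H u h' hh'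
      refine H h' fun x hx => ?_
      simp only [List.mem_cons, not_or] at hx
      rw [hh' x hx.2, Function.update_of_ne hx.1]

end Formula

/-- The ground atom that the head of `r` denotes under the assignment `h`. -/
def Rule.headAt {L : Signature} (r : Rule L) (h : Assignment L) : GroundAtom L :=
  ⟨r.pred, fun j => (r.args j).subst h⟩

namespace Program

variable {L : Signature}

/-- The immediate consequence operator in terms of assignments in place of syntactic ground
instances. -/
theorem consequence_le_iff (P : Program L) (I : Interpretation L) (A : GroundAtom L)
    (w : TruthValue) : P.consequence I A ≤ w ↔
      ∀ r ∈ P.rules, ∀ h : Assignment L, r.headAt h = A → r.body.eval I h ≤ w := by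
  classical
  rw [consequence, isLUB_le_iff (isLUB_sup _)]
  constructor
  · rintro H r hr h rfl
    let V : Set ℕ := (⋃ j, (r.args j).vars) ∪ r.body.freeVars
    have hV : V.Finite :=
      (Set.finite_iUnion fun j => (r.args j).finite_vars).union r.body.finite_freeVars
    -- A substitution must have finite support, so `h` is cut down to the variables of `r`.
    let s : ℕ → Term L ℕ := fun x => if x ∈ V then (h x).toTerm else Term.var x
    have hsV : ∀ x ∈ V, s x = (h x).toTerm := fun x hx => if_pos hx
    have hfree : r.body.FreeFor s := Formula.freeFor_of_vars_eq_empty fun x => by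
      by_cases hx : x ∈ V
      · exact Or.inl (by rw [hsV x hx, HerbrandUniverse.vars_toTerm])
      · exact Or.inr (if_neg hx)
    have hargs : (fun j => (r.args j).subst s) =
        fun j => HerbrandUniverse.toTerm ((r.args j).subst h) := by
      funext j
      rw [HerbrandUniverse.toTerm, Term.subst_subst]
      exact Term.subst_congr fun x hx => hsV x (Or.inl (Set.mem_iUnion.2 ⟨j, hx⟩))
    have hval : (r.body.subst s).value I = r.body.eval I h := by
      rw [Formula.value, Formula.eval_subst I hfree]
      refine Formula.eval_congr I fun x hx => ?_
      rw [hsV x (Or.inr hx), HerbrandUniverse.subst_toTerm]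
    rw [← hval]
    refine H ⟨r.body.subst s, ⟨r, hr, s, hV.subset fun x hx => ?_, hfree, ?_, fun j => ?_, ?_⟩, rfl⟩
    · by_contra hxV
      exact hx (if_neg hxV)
    · simp only [Rule.subst, Rule.headAt, hargs]
    · exact HerbrandUniverse.vars_toTerm _
    · exact Formula.freeVars_subst_eq_empty fun x hx => by
        rw [hsV x (Or.inr hx), HerbrandUniverse.vars_toTerm]
  · rintro H w ⟨p, ⟨r, hr, s, -, hfree, heq, -, -⟩, rfl⟩
    obtain ⟨k, as, b⟩ := r
    obtain ⟨k', us⟩ := A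
    simp only [Rule.subst, Rule.mk.injEq] at heq
    obtain ⟨rfl, hargs, rfl⟩ := heq
    rw [Formula.value, Formula.eval_subst I hfree]
    refine H _ hr _ ?_
    simp only [Rule.headAt, GroundAtom.mk.injEq, heq_eq_eq, true_and]
    funext j
    have hj := congrArg
      (fun t : Term L ℕ => t.subst (fun _ => (Term.const ⟨0, L.numConst_pos⟩ : Term L Empty)))
      (congrFun (eq_of_heq hargs) j)
    simp only [HerbrandUniverse.subst_toTerm, Term.subst_subst] at hj
    exact hj.symm

theorem eval_le_consequence {P : Program L} (I : Interpretation L) {r : Rule L} (hr : r ∈ P.rules)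
    (h : Assignment L) : r.body.eval I h ≤ P.consequence I (r.headAt h) :=
  (P.consequence_le_iff I _ _).1 le_rfl r hr h rfl

theorem isModel_iff_consequence_le {P : Program L} {I : Interpretation L} :
    I.IsModel P ↔ P.consequence I ≤ I := by
  constructor
  · intro H A
    refine (P.consequence_le_iff I A _).2 ?_
    rintro r hr h rfl
    exact H r hr h
  · exact fun H r hr h => (eval_le_consequence I hr h).trans (H _)

end Program

/-! ### Programs with a rank function -/

namespace CountableOrdinal

theorem lt_next (a : CountableOrdinal) : a < a.next :=
  Subtype.coe_lt_coe.1 (lt_add_one a.1)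

theorem next_le_iff {a b : CountableOrdinal} : a.next ≤ b ↔ a < b :=
  Order.add_one_le_iff (x := a.1) (y := b.1)

theorem next_le_next {a b : CountableOrdinal} (h : a ≤ b) : a.next ≤ b.next :=
  next_le_iff.2 (h.trans_lt (lt_next b))

end CountableOrdinal

namespace TruthValue

theorem F_le_F {a b : CountableOrdinal} : F a ≤ F b ↔ a ≤ b := Iff.rfl

theorem F_le_or_exists_lt (b : CountableOrdinal) (v : TruthValue) :
    F b ≤ v ∨ ∃ a < b, v = F a := by
  cases v with
  | F a => exact (le_or_gt b a).imp id fun h => ⟨a, h, rfl⟩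
  | zero => exact Or.inl trivial
  | T a => exact Or.inl trivial

theorem neg_antitone : Antitone neg := by
  intro v w h
  cases v <;> cases w <;> first | trivial | exact h.elim | exact CountableOrdinal.next_le_next h

end TruthValue

variable {L : Signature}

/-- The interpretation that gives the atom `A` the value `F_γ`, where `γ` is the smaller one of
the rank `e A` and `x`. -/
noncomputable def truncate (e : GroundAtom L → CountableOrdinal) (x : CountableOrdinal) :
    Interpretation L :=
  fun A => F (min (e A) x)

/-- In `P` the atom `B` follows from the double negation of `C`, and the rank of `B` exceeds that
of `C` by at most two. -/
def Program.FollowsFromNegNeg (P : Program L) (e : GroundAtom L → CountableOrdinal)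
    (B C : GroundAtom L) : Prop :=
  e B ≤ (e C).next.next ∧ ∀ I : Interpretation L, (I C).neg.neg ≤ P.consequence I B

/-- The assignment `e` of countable ordinals to ground atoms describes how the program `P`
generates the atoms, in such a way that `A ↦ F_{e A}` is the least model of `P`. An atom has rank
`0`, or follows from the double negation of an atom of nearly the same rank, or follows from each
of a family of atoms of the second kind whose ranks are cofinal in its own. -/
structure Program.IsRanked (P : Program L) (e : GroundAtom L → CountableOrdinal) : Prop where
  monotone : Monotone P.consequence
  consequence_le : P.consequence (fun A => F (e A)) ≤ fun A => F (e A)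
  cases (A : GroundAtom L) : (e A).1 = 0 ∨ (∃ C, P.FollowsFromNegNeg e A C) ∨
    ∀ z < e A, ∃ B, z < e B ∧ (∀ I : Interpretation L, I B ≤ P.consequence I A) ∧
      ∃ C, P.FollowsFromNegNeg e B C

theorem truncate_le (e : GroundAtom L → CountableOrdinal) (x : CountableOrdinal) :
    truncate e x ≤ fun A => F (e A) :=
  fun A => F_le_F.2 (min_le_left (e A) x)

theorem truncate_mono (e : GroundAtom L → CountableOrdinal) {x y : CountableOrdinal}
    (h : x ≤ y) : truncate e x ≤ truncate e y :=
  fun _ => F_le_F.2 (min_le_min_left _ h)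

/-- An interpretation between `truncate e x` and `A ↦ F_{e A}` takes the value `F_b`, `b < x`,
precisely at the atoms of rank `b`. -/
theorem eq_F_iff_of_truncate_le {e : GroundAtom L → CountableOrdinal} {x b : CountableOrdinal}
    {I : Interpretation L} (hl : truncate e x ≤ I) (hu : I ≤ fun A => F (e A)) (hb : b < x)
    (A : GroundAtom L) : I A = F b ↔ e A = b := by
  have h1 : F (min (e A) x) ≤ I A := hl A
  have h2 : I A ≤ F (e A) := hu A
  constructor
  · intro h
    rw [h, F_le_F] at h1 h2
    rcases min_le_iff.1 h1 with h1 | h1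
    · exact le_antisymm h1 h2
    · exact absurd h1 hb.not_ge
  · intro h
    rw [h, min_eq_left hb.le] at h1
    rw [h] at h2
    exact le_antisymm h2 h1

theorem ne_T_of_le {e : GroundAtom L → CountableOrdinal} {I : Interpretation L}
    (hu : I ≤ fun A => F (e A)) (A : GroundAtom L) (b : CountableOrdinal) : I A ≠ T b := by
  intro h
  have h2 : I A ≤ F (e A) := hu A
  rw [h] at h2
  exact h2

theorem eqUpTo_of_truncate_le {e : GroundAtom L → CountableOrdinal} {x b : CountableOrdinal}
    {I J : Interpretation L} (hI : truncate e x ≤ I) (hI' : I ≤ fun A => F (e A))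
    (hJ : truncate e x ≤ J) (hJ' : J ≤ fun A => F (e A)) (hb : b < x) : EqUpTo b I J := by
  intro c hc
  constructor
  · ext A
    exact (eq_F_iff_of_truncate_le hI hI' (hc.trans_lt hb) A).trans
      (eq_F_iff_of_truncate_le hJ hJ' (hc.trans_lt hb) A).symm
  · ext A
    exact iff_of_false (ne_T_of_le hI' A c) (ne_T_of_le hJ' A c)

namespace Program.IsRanked

variable {P : Program L} {e : GroundAtom L → CountableOrdinal}

theorem truncate_next_le_of_followsFromNegNeg {x : CountableOrdinal} {B C : GroundAtom L}
    (h : P.FollowsFromNegNeg e B C) :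
    F (min (e B) x.next) ≤ P.consequence (truncate e x) B := by
  refine le_trans (F_le_F.2 ?_) (h.2 (truncate e x))
  rcases le_total (e C) x with hx | hx
  · rw [min_eq_left hx]
    exact (min_le_left _ _).trans h.1
  · rw [min_eq_right hx]
    exact (min_le_right _ _).trans (CountableOrdinal.lt_next _).le

theorem truncate_le_consequence (hP : P.IsRanked e) (x : CountableOrdinal) :
    truncate e x ≤ P.consequence (truncate e x) := by
  intro A
  rcases F_le_or_exists_lt (min (e A) x) (P.consequence (truncate e x) A) with h | ⟨z, hz, hzA⟩
  · exact h
  rcases hP.cases A with h | ⟨C, hC⟩ | h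
  · have hzA : z.1 < (e A).1 := hz.trans_le (min_le_left _ _)
    exact absurd (hzA.trans_eq h) not_lt_zero
  · exact (truncate_mono e (CountableOrdinal.lt_next x).le A).trans
      (truncate_next_le_of_followsFromNegNeg hC)
  · obtain ⟨B, hzB, hBA, -⟩ := h z (hz.trans_le (min_le_left _ _))
    have hle : F (min (e B) x) ≤ F z := hzA ▸ hBA (truncate e x)
    rcases min_le_iff.1 (F_le_F.1 hle) with h | h
    · exact absurd hzB h.not_gt
    · exact absurd (hz.trans_le (min_le_right _ _)) h.not_gt

/-- Two applications of the consequence operator separate the atoms of rank `x` from those of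
greater rank. -/
theorem truncate_next_le_consequence (hP : P.IsRanked e) (x : CountableOrdinal) :
    truncate e x.next ≤ P.consequence (P.consequence (truncate e x)) := by
  have step := hP.monotone (hP.truncate_le_consequence x)
  intro A
  rcases hP.cases A with h | ⟨C, hC⟩ | h
  · have h0 : truncate e x.next A = truncate e x A := by
      have h0 : ∀ y, e A ≤ y := fun y => Subtype.coe_le_coe.1 (h ▸ zero_le)
      rw [truncate, truncate, min_eq_left (h0 _), min_eq_left (h0 _)]
    rw [h0]
    exact (hP.truncate_le_consequence x A).trans (step A)
  · exact (truncate_next_le_of_followsFromNegNeg hC).trans (step A)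
  · rcases le_or_gt (e A) x with hx | hx
    · have h0 : truncate e x.next A = truncate e x A := by
        rw [truncate, truncate, min_eq_left hx,
          min_eq_left (hx.trans (CountableOrdinal.lt_next x).le)]
      rw [h0]
      exact (hP.truncate_le_consequence x A).trans (step A)
    · obtain ⟨B, hxB, hBA, C, hC⟩ := h x hx
      refine le_trans ?_ ((truncate_next_le_of_followsFromNegNeg hC).trans (hBA _))
      rw [min_eq_right (CountableOrdinal.next_le_iff.2 hxB)]
      exact F_le_F.2 (min_le_right _ _)

theorem leAt_truncate (hP : P.IsRanked e) (a : CountableOrdinal) :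
    LEAt a (truncate e a) (P.consequence (truncate e a)) := by
  have hu : P.consequence (truncate e a) ≤ fun A => F (e A) :=
    (hP.monotone (truncate_le e a)).trans hP.consequence_le
  refine ⟨fun b hb => eqUpTo_of_truncate_le le_rfl (truncate_le e a)
    (hP.truncate_le_consequence a) hu hb, fun A hA => ?_, fun A hA => ?_⟩
  · have hA : P.consequence (truncate e a) A = F a := hA
    have h := hu A
    rw [hA] at h
    exact congrArg F (min_eq_right (F_le_F.1 h))
  · exact absurd hA (ne_T_of_le (truncate_le e a) A a)

/-- All stages of the iteration that starts from `truncate e a` lie between `truncate e a` and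
`A ↦ F_{e A}`; from the second stage on, they lie above `truncate e a.next`. -/
theorem iterate_bounds (hP : P.IsRanked e) (a : CountableOrdinal) (b : Ordinal.{0}) :
    truncate e a ≤ P.iterate a (truncate e a) b ∧
      (P.iterate a (truncate e a) b ≤ fun A => F (e A)) ∧
      (2 ≤ b → truncate e a.next ≤ P.iterate a (truncate e a) b) := by
  induction b using Ordinal.limitRecOn with
  | zero =>
    rw [Program.iterate, Ordinal.limitRecOn_zero]
    exact ⟨le_rfl, truncate_le e a, fun h => by simp at h⟩
  | add_one b ih =>
    have hb : P.iterate a (truncate e a) (b + 1) =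
        P.consequence (P.iterate a (truncate e a) b) := by
      rw [Program.iterate, Ordinal.limitRecOn_add_one]
      rfl
    rw [hb]
    obtain ⟨h1, h2, h3⟩ := ih
    refine ⟨(hP.truncate_le_consequence a).trans (hP.monotone h1),
      (hP.monotone h2).trans hP.consequence_le, fun h => ?_⟩
    rcases le_or_gt 2 b with hb | hb
    · exact (hP.truncate_le_consequence _).trans (hP.monotone (h3 hb))
    · have hb1 : b = 0 + 1 := by
        refine le_antisymm ?_ ?_
        · rw [zero_add]
          exact Order.lt_add_one_iff.1 (by rwa [one_add_one_eq_two])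
        · rw [zero_add]
          exact Order.lt_add_one_iff.1 (one_lt_two.trans_le h)
      subst hb1
      rw [Program.iterate, Ordinal.limitRecOn_add_one, Ordinal.limitRecOn_zero]
      exact hP.truncate_next_le_consequence a
  | limit b hb ih =>
    have h2b : (2 : Ordinal.{0}) < b := by
      exact_mod_cast (Ordinal.natCast_lt_omega0 2).trans_le (Ordinal.omega0_le_of_isSuccLimit hb)
    suffices H : truncate e a.next ≤ P.iterate a (truncate e a) b ∧
        P.iterate a (truncate e a) b ≤ fun A => F (e A) from
      ⟨(truncate_mono e (CountableOrdinal.lt_next a).le).trans H.1, H.2, fun _ => H.1⟩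
    refine forall_and.1 fun A => ?_
    rw [Program.iterate, Ordinal.limitRecOn_limit _ _ _ _ hb]
    rcases lt_or_ge (e A) a with hea | hea
    · have hA : truncate e a A = F (e A) := congrArg F (min_eq_left hea.le)
      rw [if_pos (by rw [hA]; exact WithTop.coe_lt_coe.2 hea), hA]
      exact ⟨truncate_le e _ A, le_rfl⟩
    have hA : truncate e a A = F a := congrArg F (min_eq_right hea)
    rw [if_neg (by rw [hA]; exact lt_irrefl _), if_neg]
    swap
    · rintro ⟨c, hc, h⟩
      exact ne_T_of_le (ih c hc).2.1 A a h
    split_ifs with h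
    · -- The value at the second stage bounds the rank.
      have h2 : F (min (e A) a.next) ≤ F a := by
        have := (ih 2 h2b).2.2 le_rfl A
        rwa [show P.iterate a (truncate e a) 2 A = F a from h 2 h2b] at this
      refine ⟨h2, F_le_F.2 hea⟩
    · refine ⟨F_le_F.2 (min_le_right _ _), F_le_F.2 (CountableOrdinal.next_le_iff.2 ?_)⟩
      refine lt_of_le_of_ne hea fun hea' => h fun c hc => ?_
      have h1 := (ih c hc).1 A
      have h2 : P.iterate a (truncate e a) c A ≤ F (e A) := (ih c hc).2.1 A
      rw [hA] at h1
      rw [← hea'] at h2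
      exact le_antisymm h2 h1

/-- The approximant `M_a` gives the atoms of rank at most `a` their rank as value, and the other
ones a value `F_b` with `b > a`. -/
theorem approximant_bounds (hP : P.IsRanked e) (a : CountableOrdinal) :
    truncate e a.next ≤ P.approximant a ∧ P.approximant a ≤ fun A => F (e A) := by
  induction a using WellFoundedLT.induction with
  | ind a ih =>
    have hunion : union a (fun c _ => P.approximant c) = truncate e a := by
      funext A
      have key : ∀ z < a, (P.approximant z A = F z ∨ P.approximant z A = T z ↔ e A = z) :=
        fun z hz => (or_iff_left (ne_T_of_le (ih z hz).2 A z)).trans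
          (eq_F_iff_of_truncate_le (ih z hz).1 (ih z hz).2 (CountableOrdinal.lt_next z) A)
      unfold union
      split_ifs with h
      · have hz := (key _ h.choose_spec.1).1 h.choose_spec.2
        have hF := (or_iff_left (ne_T_of_le (ih _ h.choose_spec.1).2 A _)).1 h.choose_spec.2
        refine hF.trans (congrArg F ?_)
        rw [min_eq_left (hz.trans_lt h.choose_spec.1).le, hz]
      · refine congrArg F (min_eq_right ?_).symm
        by_contra hlt
        exact h ⟨e A, not_le.1 hlt, (key _ (not_le.1 hlt)).2 rfl⟩
    rw [Program.approximant_eq, Program.approximantStep, hunion, if_pos]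
    · obtain ⟨-, h2, h3⟩ := hP.iterate_bounds a ω₁
      refine ⟨h3 ?_, h2⟩
      exact_mod_cast ((Ordinal.natCast_lt_omega0 2).trans (Ordinal.omega0_lt_omega_one)).le
    · refine ⟨fun c hc z hz => ?_, hP.leAt_truncate a⟩
      have hzc : z.next ≤ c.next := CountableOrdinal.next_le_next hz.le
      exact eqUpTo_of_truncate_le (ih z (hz.trans hc)).1 (ih z (hz.trans hc)).2
        ((truncate_mono e hzc).trans (ih c hc).1) (ih c hc).2 (CountableOrdinal.lt_next z)

theorem mem_depthSet_iff (hP : P.IsRanked e) {d : Ordinal.{0}} :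
    d ∈ P.depthSet ↔ d < ω₁ ∧ ∀ A, (e A).1 < d := by
  refine and_congr_right fun _ => ⟨fun h A => ?_, fun h c hc => ⟨?_, ?_⟩⟩
  · by_contra hA
    obtain ⟨h1, h2⟩ := hP.approximant_bounds (e A)
    exact (h (e A) (not_lt.1 hA)).1.subset
      ((eq_F_iff_of_truncate_le h1 h2 (CountableOrdinal.lt_next _) A).2 rfl)
  · obtain ⟨h1, h2⟩ := hP.approximant_bounds c
    refine Set.eq_empty_of_forall_notMem fun A hA => ?_
    have hA := (eq_F_iff_of_truncate_le h1 h2 (CountableOrdinal.lt_next _) A).1 hA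
    exact ((h A).trans_le hc).ne (congrArg Subtype.val hA)
  · exact Set.eq_empty_of_forall_notMem fun A hA =>
      ne_T_of_le (hP.approximant_bounds c).2 A c hA

theorem rank_lt_depth (hP : P.IsRanked e) {d : Ordinal.{0}} (hd : d < ω₁)
    (hed : ∀ A, (e A).1 < d) (A : GroundAtom L) : e A < P.depth :=
  (hP.mem_depthSet_iff.1 (csInf_mem ⟨d, hP.mem_depthSet_iff.2 ⟨hd, hed⟩⟩)).2 A

theorem model_eq (hP : P.IsRanked e) {d : Ordinal.{0}} (hd : d < ω₁)
    (hed : ∀ A, (e A).1 < d) : P.model = fun A => F (e A) := by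
  funext A
  have hA := hP.rank_lt_depth hd hed A
  obtain ⟨h1, h2⟩ := hP.approximant_bounds P.depth
  have hF : P.approximant P.depth A = F (e A) := (eq_F_iff_of_truncate_le h1 h2
    (hA.trans (CountableOrdinal.lt_next _)) A).2 rfl
  rw [Program.model, hF]
  exact if_pos (WithTop.coe_lt_coe.2 hA)

theorem isLeastModel (hP : P.IsRanked e) :
    Interpretation.IsLeastModel (fun A => F (e A)) P := by
  refine ⟨Program.isModel_iff_consequence_le.2 hP.consequence_le, fun J hJ => ?_⟩
  rw [Program.isModel_iff_consequence_le] at hJ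
  refine or_iff_not_imp_right.2 fun hne => ?_
  let S : Set CountableOrdinal := {a | ¬ EqUpTo a (fun A => F (e A)) J}
  have hS : S.Nonempty := by
    obtain ⟨A, hA⟩ := Function.ne_iff.1 hne
    exact ⟨e A, fun h => hA ((h (e A) le_rfl).1.subset (rfl : A ∈ _)).symm⟩
  set a := wellFounded_lt.min S hS
  have heq : ∀ b < a, EqUpTo b (fun A => F (e A)) J := fun b hb =>
    not_not.1 fun h => wellFounded_lt.not_lt_min S h hb
  -- Below `a` the two interpretations agree, so `J` lies above `truncate e a`; as `J` is a
  -- pre-fixed point, two applications of the consequence operator give the next level.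
  have hle : truncate e a ≤ J := by
    intro A
    rcases F_le_or_exists_lt (min (e A) a) (J A) with h | ⟨z, hz, hzA⟩
    · exact h
    · have := (heq z (hz.trans_le (min_le_right _ _)) z le_rfl).1.superset hzA
      have hez : e A = z := TruthValue.F.inj this
      exact absurd (hz.trans_le (min_le_left _ _)) (by rw [hez]; exact lt_irrefl z)
  have hnext : truncate e a.next ≤ J :=
    (hP.truncate_next_le_consequence a).trans
      ((hP.monotone ((hP.monotone hle).trans hJ)).trans hJ)
  refine ⟨a, ⟨heq, fun A hA => ?_, fun A hA => ?_⟩, wellFounded_lt.min_mem S hS⟩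
  · have hA : J A = F a := hA
    have h1 := hnext A
    rw [hA] at h1
    rcases min_le_iff.1 (F_le_F.1 h1) with h | h
    · refine congrArg F (le_antisymm h (not_lt.1 fun hlt => ?_))
      have : J A = F (e A) := (heq (e A) hlt (e A) le_rfl).1.subset (rfl : A ∈ _)
      exact hlt.ne (TruthValue.F.inj (this.symm.trans hA))
    · exact absurd (CountableOrdinal.lt_next a) h.not_gt
  · exact absurd hA (ne_T_of_le (e := e) le_rfl A a)

end Program.IsRanked

/-! ### The ordinals assigned to the atoms -/

theorem omega_pow_lt_omega_one (n : ℕ) : (ω : Ordinal.{0}) ^ n < ω₁ := by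
  rw [← Ordinal.opow_natCast]
  exact Ordinal.isPrincipal_opow_omega 1 Ordinal.omega0_lt_omega_one
    ((Ordinal.natCast_lt_omega0 n).trans Ordinal.omega0_lt_omega_one)

theorem gOrdinal_zero_left (k : Fin 1 → ℕ) : gOrdinal 0 k = ((2 * k 0 : ℕ) : Ordinal.{0}) := by
  simp [gOrdinal]

/-- The leading summand of the ordinal, split off. -/
theorem gOrdinal_succ_left (N : ℕ) (k : Fin (N + 2) → ℕ) :
    gOrdinal (N + 1) k = ω ^ (N + 1) * (k 0 : Ordinal.{0}) + gOrdinal N fun i => k i.succ := by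
  simp only [gOrdinal, List.ofFn_succ, List.sum_cons, add_assoc, Fin.castSucc_zero, Fin.val_zero,
    Nat.sub_zero, Fin.val_succ, Nat.add_sub_add_right, Fin.castSucc_succ, Fin.succ_last]

theorem gOrdinal_eq_zero {N : ℕ} {k : Fin (N + 1) → ℕ} (hk : ∀ i, k i = 0) :
    gOrdinal N k = 0 := by
  induction N with
  | zero => simp [gOrdinal_zero_left, hk]
  | succ N ih => rw [gOrdinal_succ_left, ih fun i => hk i.succ, hk 0]; simp

theorem gOrdinal_eq_add_two {N : ℕ} {k k' : Fin (N + 1) → ℕ}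
    (h : ∀ i, i ≠ Fin.last N → k i = k' i) (hlast : k (Fin.last N) = k' (Fin.last N) + 1) :
    gOrdinal N k = gOrdinal N k' + 1 + 1 := by
  simp only [gOrdinal, hlast, h _ (Fin.castSucc_ne_last _), mul_add, mul_one]
  push_cast
  simp only [add_assoc, one_add_one_eq_two]

theorem gOrdinal_lt (N : ℕ) (k : Fin (N + 1) → ℕ) : gOrdinal N k < ω ^ (N + 1) := by
  induction N with
  | zero =>
    rw [gOrdinal_zero_left, zero_add, pow_one]
    exact Ordinal.natCast_lt_omega0 _
  | succ N ih =>
    have h1 : ω ^ (N + 1) * ((k 0 + 1 : ℕ) : Ordinal.{0}) < ω ^ (N + 1 + 1) := by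
      rw [pow_succ ω (N + 1)]
      exact mul_lt_mul_of_pos_left (Ordinal.natCast_lt_omega0 _) (pow_pos Ordinal.omega0_pos _)
    rw [gOrdinal_succ_left]
    refine lt_trans ?_ h1
    push_cast
    rw [mul_add, mul_one]
    exact (add_lt_add_iff_left _).2 (ih _)

/-- The ordinals of the atoms `G(…, f(…))` are cofinal in `ω ^ (N + 1)`. -/
theorem exists_lt_gOrdinal {N : ℕ} {x : Ordinal.{0}} (hx : x < ω ^ (N + 1)) :
    ∃ k : Fin (N + 1) → ℕ, 0 < k (Fin.last N) ∧ x < gOrdinal N k := by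
  cases N with
  | zero =>
    rw [zero_add, pow_one] at hx
    obtain ⟨n, rfl⟩ := Ordinal.lt_omega0.1 hx
    refine ⟨fun _ => n + 1, Nat.succ_pos _, ?_⟩
    rw [gOrdinal_zero_left, Nat.cast_lt]
    omega
  | succ N =>
    rw [pow_succ ω (N + 1), Ordinal.lt_mul_iff_of_isSuccLimit Ordinal.isSuccLimit_omega0] at hx
    obtain ⟨c, hc, hx⟩ := hx
    obtain ⟨n, rfl⟩ := Ordinal.lt_omega0.1 hc
    refine ⟨Fin.cons n fun _ => 1, ?_, ?_⟩
    · rw [← Fin.succ_last, Fin.cons_succ]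
      exact one_pos
    · rw [gOrdinal_succ_left, Fin.cons_zero]
      exact hx.trans_le le_self_add

/-- `k'` is one of the tuples whose atoms are the premises of the limit rule with index `m` for
the atom with the tuple `k`: the entry at `m` is decreased by one, the later entries, which are
zero in `k`, are arbitrary. -/
def IsPremise {N : ℕ} (m : Fin N) (k k' : Fin (N + 1) → ℕ) : Prop :=
  (∀ i < m.castSucc, k i = k' i) ∧ k m.castSucc = k' m.castSucc + 1 ∧ ∀ i > m.castSucc, k i = 0

theorem isPremise_zero_iff {N : ℕ} {k k' : Fin (N + 2) → ℕ} :
    IsPremise 0 k k' ↔ k 0 = k' 0 + 1 ∧ ∀ i : Fin (N + 1), k i.succ = 0 := by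
  simp only [IsPremise, Fin.castSucc_zero, Fin.not_lt_zero, IsEmpty.forall_iff, implies_true,
    true_and, gt_iff_lt]
  refine and_congr_right fun _ => ⟨fun h i => h _ i.succ_pos, fun h i hi => ?_⟩
  obtain ⟨j, rfl⟩ := Fin.exists_succ_eq.2 hi.ne'
  exact h j

theorem isPremise_succ_iff {N : ℕ} {m : Fin N} {k k' : Fin (N + 2) → ℕ} :
    IsPremise m.succ k k' ↔
      k 0 = k' 0 ∧ IsPremise m (fun i => k i.succ) fun i => k' i.succ := by
  simp only [IsPremise, Fin.castSucc_succ, gt_iff_lt]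
  constructor
  · rintro ⟨h1, h2, h3⟩
    exact ⟨h1 0 (Fin.succ_pos _), fun i hi => h1 _ (Fin.succ_lt_succ_iff.2 hi), h2,
      fun i hi => h3 _ (Fin.succ_lt_succ_iff.2 hi)⟩
  · rintro ⟨h0, h1, h2, h3⟩
    refine ⟨fun i hi => ?_, h2, fun i hi => ?_⟩
    · induction i using Fin.cases with
      | zero => exact h0
      | succ i => exact h1 i (Fin.succ_lt_succ_iff.1 hi)
    · induction i using Fin.cases with
      | zero => exact absurd hi (Fin.not_lt_zero _)
      | succ i => exact h3 i (Fin.succ_lt_succ_iff.1 hi)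

theorem gOrdinal_eq_of_isPremise_zero {N : ℕ} {k k' : Fin (N + 2) → ℕ} (h : IsPremise 0 k k') :
    gOrdinal (N + 1) k = ω ^ (N + 1) * (k' 0 : Ordinal.{0}) + ω ^ (N + 1) := by
  obtain ⟨h0, hs⟩ := isPremise_zero_iff.1 h
  rw [gOrdinal_succ_left, gOrdinal_eq_zero hs, h0, add_zero]
  push_cast
  rw [mul_add, mul_one]

theorem gOrdinal_lt_of_isPremise {N : ℕ} {m : Fin N} {k k' : Fin (N + 1) → ℕ}
    (h : IsPremise m k k') : gOrdinal N k' < gOrdinal N k := by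
  induction N with
  | zero => exact m.elim0
  | succ N ih =>
    induction m using Fin.cases with
    | zero =>
      rw [gOrdinal_eq_of_isPremise_zero h, gOrdinal_succ_left]
      exact (add_lt_add_iff_left _).2 (gOrdinal_lt N _)
    | succ m =>
      obtain ⟨h0, hs⟩ := isPremise_succ_iff.1 h
      rw [gOrdinal_succ_left, gOrdinal_succ_left, h0]
      exact (add_lt_add_iff_left _).2 (ih hs)

/-- The ordinals of the premises `G(…, f(…))` of a limit rule are cofinal in the ordinal of its
conclusion. -/
theorem exists_isPremise_lt_gOrdinal {N : ℕ} {m : Fin N} {k : Fin (N + 1) → ℕ}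
    (hm : k m.castSucc ≠ 0) (h0 : ∀ i > m.castSucc, k i = 0) {x : Ordinal.{0}}
    (hx : x < gOrdinal N k) :
    ∃ k', IsPremise m k k' ∧ 0 < k' (Fin.last N) ∧ x < gOrdinal N k' := by
  induction N generalizing x with
  | zero => exact m.elim0
  | succ N ih =>
    induction m using Fin.cases with
    | zero =>
      obtain ⟨j, hj⟩ := Nat.exists_eq_succ_of_ne_zero hm
      have hp : ∀ k' : Fin (N + 1) → ℕ,
          IsPremise 0 k (Fin.cons j k' : Fin (N + 2) → ℕ) := fun k' =>
        isPremise_zero_iff.2 ⟨hj, fun i => h0 _ i.succ_pos⟩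
      rw [gOrdinal_eq_of_isPremise_zero (hp fun _ => 0),
        Ordinal.lt_add_iff (pow_pos Ordinal.omega0_pos _).ne'] at hx
      obtain ⟨d, hd, hx⟩ := hx
      obtain ⟨k', hk', hdk⟩ := exists_lt_gOrdinal hd
      refine ⟨_, hp k', ?_, ?_⟩
      · rwa [← Fin.succ_last, Fin.cons_succ]
      · rw [gOrdinal_succ_left]
        exact hx.trans_lt ((add_lt_add_iff_left _).2 hdk)
    | succ m =>
      have hm' : k m.castSucc.succ ≠ 0 := hm
      have h0' : ∀ i > m.castSucc, k i.succ = 0 := fun i hi =>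
        h0 _ (Fin.succ_lt_succ_iff.2 hi)
      have hpos : gOrdinal N (fun i => k i.succ) ≠ 0 := by
        have hp : IsPremise m (fun i => k i.succ)
            (Function.update (fun i => k i.succ) m.castSucc (k m.castSucc.succ - 1)) := by
          refine ⟨fun i hi => ?_, ?_, h0'⟩
          · rw [Function.update_of_ne hi.ne]
          · rw [Function.update_self]
            exact (Nat.sub_add_cancel (Nat.pos_of_ne_zero hm')).symm
        exact (zero_le.trans_lt (gOrdinal_lt_of_isPremise hp)).ne'
      rw [gOrdinal_succ_left, Ordinal.lt_add_iff hpos] at hx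
      obtain ⟨d, hd, hx⟩ := hx
      obtain ⟨k', hp, hk', hdk⟩ := ih hm' h0' hd
      refine ⟨Fin.cons (k 0) k', isPremise_succ_iff.2 ⟨rfl, hp⟩, ?_, ?_⟩
      · rwa [← Fin.succ_last, Fin.cons_succ]
      · rw [gOrdinal_succ_left]
        exact hx.trans_lt ((add_lt_add_iff_left _).2 hdk)

/-! ### The programs `P_n` -/

variable {N : ℕ}

theorem fPow_succ (n : ℕ) : fPow N (n + 1) = fTerm (fPow N n) :=
  Function.iterate_succ_apply' _ _ _

theorem exists_eq_fPow (u : HerbrandUniverse (exSignature N)) : ∃ n, u = fPow N n := by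
  induction u with
  | var x => exact x.elim
  | const c => exact ⟨0, congrArg Term.const (Subsingleton.elim (α := Fin 1) c 0)⟩
  | func i ts ih =>
    obtain rfl : i = 0 := Subsingleton.elim (α := Fin 1) i 0
    obtain ⟨n, hn⟩ := ih (0 : Fin 1)
    refine ⟨n + 1, ?_⟩
    rw [fPow_succ, ← hn]
    exact congrArg (Term.func 0)
      (funext fun j => congrArg ts (Subsingleton.elim (α := Fin 1) j 0))

theorem cTerm_ne_fTerm {V : Type} (t : Term (exSignature N) V) : cTerm ≠ fTerm t := nofun

theorem fTerm_injective {V : Type} : Function.Injective (fTerm (N := N) (V := V)) := by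
  intro t t' h
  injection h with _ h
  exact congrFun h (0 : Fin 1)

theorem fPow_injective : Function.Injective (fPow N) := by
  intro a
  induction a with
  | zero =>
    rintro (_ | b) h
    · rfl
    · exact absurd (h.trans (fPow_succ b)) (cTerm_ne_fTerm _)
  | succ a ih =>
    rintro (_ | b) h
    · exact absurd (h.symm.trans (fPow_succ a)) (cTerm_ne_fTerm _)
    · rw [fPow_succ, fPow_succ] at h
      rw [ih (fTerm_injective h)]

theorem gAtom_injective : Function.Injective (gAtom N) := by
  intro k k' h
  have h2 := eq_of_heq (GroundAtom.mk.inj h).2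
  exact funext fun i => fPow_injective (congrFun h2 i)

theorem gAtom_ne_hAtom (k : Fin (N + 1) → ℕ) : gAtom N k ≠ hAtom N := by
  intro h
  exact absurd (GroundAtom.mk.inj h).1 Fin.zero_ne_one

theorem eq_gAtom_or_eq_hAtom (A : GroundAtom (exSignature N)) :
    (∃ k, A = gAtom N k) ∨ A = hAtom N := by
  obtain ⟨p, as⟩ := A
  match p, as with
  | 0, as =>
    choose k hk using fun i => exists_eq_fPow (as i)
    exact Or.inl ⟨k, congrArg (GroundAtom.mk 0) (funext hk)⟩
  | 1, as => exact Or.inr (congrArg (GroundAtom.mk 1) (funext fun i : Fin 0 => i.elim0))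

/-- The assignment that sends `x_i` to `f^{n i}(c)`; all assignments are of this form. -/
def fAssignment (N : ℕ) (n : ℕ → ℕ) : Assignment (exSignature N) := fun x => fPow N (n x)

theorem exists_eq_fAssignment (h : Assignment (exSignature N)) :
    ∃ n, h = fAssignment N n := by
  choose n hn using fun x => exists_eq_fPow (h x)
  exact ⟨n, funext hn⟩

/-- The extension of a tuple to a sequence by zeros. -/
def extend (k : Fin (N + 1) → ℕ) (x : ℕ) : ℕ := if h : x < N + 1 then k ⟨x, h⟩ else 0

theorem extend_val (k : Fin (N + 1) → ℕ) : (fun i : Fin (N + 1) => extend k i) = k :=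
  funext fun i => dif_pos i.2

theorem eval_gVars (I : Interpretation (exSignature N)) (n : ℕ → ℕ) :
    (gVars N).eval I (fAssignment N n) = I (gAtom N fun i => n i) := rfl

theorem headAt_lastRule (n : ℕ → ℕ) : (lastRule N).headAt (fAssignment N n) =
    gAtom N fun i => if i = Fin.last N then n i + 1 else n i := by
  refine congrArg (GroundAtom.mk 0) (funext fun i : Fin (N + 1) => ?_)
  change Term.subst _ (if i = Fin.last N then _ else _) =
    fPow N (if i = Fin.last N then _ else _)
  split_ifs
  · exact (fPow_succ _).symm
  · rfl

theorem headAt_limitRule (m : Fin N) (n : ℕ → ℕ) : (limitRule N m).headAt (fAssignment N n) =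
    gAtom N fun i => if (i : ℕ) < m then n i else if (i : ℕ) = m then n i + 1 else 0 := by
  refine congrArg (GroundAtom.mk 0) (funext fun i : Fin (N + 1) => ?_)
  change Term.subst _ (if (i : ℕ) < m then _ else if (i : ℕ) = m then _ else _) =
    fPow N (if (i : ℕ) < m then _ else if (i : ℕ) = m then _ else _)
  split_ifs
  · rfl
  · exact (fPow_succ _).symm
  · rfl

theorem headAt_hRule (h : Assignment (exSignature N)) : (hRule N).headAt h = hAtom N :=
  congrArg (GroundAtom.mk 1) (funext fun i : Fin 0 => i.elim0)

theorem lastRule_mem : lastRule N ∈ (exProgram N).rules := Or.inl (Or.inl rfl)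

theorem hRule_mem : hRule N ∈ (exProgram N).rules := Or.inl (Or.inr rfl)

theorem limitRule_mem (m : Fin N) : limitRule N m ∈ (exProgram N).rules := Or.inr ⟨m, rfl⟩

theorem monotone_eval_gVars (h : Assignment (exSignature N)) :
    Monotone fun I => (gVars N).eval I h := fun _ _ hIJ => hIJ _

theorem monotone_eval_exs {L : Signature} {p : Formula L}
    (hp : ∀ h, Monotone fun I => p.eval I h) (vs : List ℕ) (h : Assignment L) :
    Monotone fun I => (Formula.exs vs p).eval I h := by
  intro I J hIJ
  refine (Formula.eval_exs_le_iff I vs p h _).2 fun h' hh' => (hp h' hIJ).trans ?_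
  exact (Formula.eval_exs_le_iff J vs p h _).1 le_rfl h' hh'

theorem monotone_consequence_exProgram : Monotone (exProgram N).consequence := by
  intro I J hIJ A
  refine (Program.consequence_le_iff _ _ _ _).2 ?_
  rintro r hr h rfl
  refine le_trans ?_ (Program.eval_le_consequence J hr h)
  rcases hr with (rfl | rfl) | ⟨m, rfl⟩
  · exact neg_antitone (neg_antitone (monotone_eval_gVars h hIJ))
  · exact monotone_eval_exs monotone_eval_gVars _ h hIJ
  · exact monotone_eval_exs monotone_eval_gVars _ h hIJ

theorem gOrdinal_lt_omega_one (k : Fin (N + 1) → ℕ) : gOrdinal N k < ω₁ :=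
  (gOrdinal_lt N k).trans (omega_pow_lt_omega_one _)

open Classical in
/-- The rank of a ground atom: the ordinal `gOrdinal N k` for `G(f^{k_0}(c), …, f^{k_N}(c))`, and
`ω ^ (N + 1)` for `H`. -/
noncomputable def exRank (N : ℕ) (A : GroundAtom (exSignature N)) : CountableOrdinal :=
  if h : ∃ k, A = gAtom N k then ⟨gOrdinal N h.choose, gOrdinal_lt_omega_one _⟩
  else ⟨ω ^ (N + 1), omega_pow_lt_omega_one _⟩

theorem exRank_gAtom (k : Fin (N + 1) → ℕ) :
    exRank N (gAtom N k) = ⟨gOrdinal N k, gOrdinal_lt_omega_one k⟩ := by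
  have h : ∃ k', gAtom N k = gAtom N k' := ⟨k, rfl⟩
  rw [exRank, dif_pos h]
  exact Subtype.ext (congrArg (gOrdinal N) (gAtom_injective h.choose_spec).symm)

theorem exRank_gAtom_eq_next_next {k k' : Fin (N + 1) → ℕ}
    (h : ∀ i, i ≠ Fin.last N → k i = k' i) (hlast : k (Fin.last N) = k' (Fin.last N) + 1) :
    exRank N (gAtom N k) = (exRank N (gAtom N k')).next.next := by
  rw [exRank_gAtom, exRank_gAtom]
  exact Subtype.ext (gOrdinal_eq_add_two h hlast)

theorem exRank_hAtom : exRank N (hAtom N) = ⟨ω ^ (N + 1), omega_pow_lt_omega_one _⟩ :=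
  dif_neg fun ⟨k, hk⟩ => gAtom_ne_hAtom k hk.symm

theorem exRank_lt (A : GroundAtom (exSignature N)) : (exRank N A).1 < ω ^ (N + 1) + 1 := by
  rcases eq_gAtom_or_eq_hAtom A with ⟨k, rfl⟩ | rfl
  · rw [exRank_gAtom]
    exact (gOrdinal_lt N k).trans (lt_add_one _)
  · rw [exRank_hAtom]
    exact lt_add_one _

theorem followsFromNegNeg_gAtom {k : Fin (N + 1) → ℕ} (hk : 0 < k (Fin.last N)) :
    ∃ C, (exProgram N).FollowsFromNegNeg (exRank N) (gAtom N k) C := by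
  let k' := Function.update k (Fin.last N) (k (Fin.last N) - 1)
  have hne : ∀ i, i ≠ Fin.last N → k i = k' i := fun i hi => (Function.update_of_ne hi _ _).symm
  have hlast : k (Fin.last N) = k' (Fin.last N) + 1 := by
    simp only [k', Function.update_self]
    omega
  refine ⟨gAtom N k', (exRank_gAtom_eq_next_next hne hlast).le, fun I => ?_⟩
  · have h := Program.eval_le_consequence I lastRule_mem (fAssignment N (extend k'))
    rw [headAt_lastRule] at h
    convert h using 2
    · change _ = ((gVars N).eval I (fAssignment N (extend k'))).neg.neg
      rw [eval_gVars, extend_val]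
    · refine congrArg (gAtom N) (funext fun i => ?_)
      have hi : extend k' i = k' i := congrFun (extend_val k') i
      rw [hi]
      split_ifs with h
      · rw [h, hlast]
      · exact hne i h

theorem le_consequence_gAtom {m : Fin N} {k k' : Fin (N + 1) → ℕ} (h : IsPremise m k k')
    (I : Interpretation (exSignature N)) :
    I (gAtom N k') ≤ (exProgram N).consequence I (gAtom N k) := by
  have hle := Program.eval_le_consequence I (limitRule_mem m) (fAssignment N (extend k'))
  rw [headAt_limitRule] at hle
  have hk : (fun i : Fin (N + 1) => if (i : ℕ) < m then extend k' i
      else if (i : ℕ) = m then extend k' i + 1 else 0) = k := by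
    funext i
    have hi : extend k' i = k' i := congrFun (extend_val k') i
    rw [hi]
    split_ifs with h1 h2
    · exact (h.1 i h1).symm
    · rw [show i = m.castSucc from Fin.ext h2]
      exact h.2.1.symm
    · exact (h.2.2 i (Fin.lt_def.2 (lt_of_le_of_ne (not_lt.1 h1) (Ne.symm h2)))).symm
  rw [hk] at hle
  have h' := (Formula.eval_exs_le_iff I _ _ _ _).1 hle (fAssignment N (extend k'))
    fun _ _ => rfl
  rwa [eval_gVars, extend_val] at h'

theorem le_consequence_hAtom (k : Fin (N + 1) → ℕ) (I : Interpretation (exSignature N)) :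
    I (gAtom N k) ≤ (exProgram N).consequence I (hAtom N) := by
  have hle := Program.eval_le_consequence I hRule_mem (fAssignment N (extend k))
  rw [headAt_hRule] at hle
  have h' := (Formula.eval_exs_le_iff I _ _ _ _).1 hle (fAssignment N (extend k))
    fun _ _ => rfl
  rwa [eval_gVars, extend_val] at h'

theorem consequence_exRank_le :
    (exProgram N).consequence (fun A => F (exRank N A)) ≤ fun A => F (exRank N A) := by
  intro A
  refine (Program.consequence_le_iff _ _ _ _).2 ?_
  rintro r hr h rfl
  obtain ⟨n, rfl⟩ := exists_eq_fAssignment h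
  rcases hr with (rfl | rfl) | ⟨m, rfl⟩
  · change ((gVars N).eval _ (fAssignment N n)).neg.neg ≤ _
    rw [eval_gVars, headAt_lastRule]
    have h := exRank_gAtom_eq_next_next (k := fun i => if i = Fin.last N then n i + 1 else n i)
      (k' := fun i => n i) (fun i hi => if_neg hi) (if_pos rfl)
    exact F_le_F.2 h.ge
  · refine (Formula.eval_exs_le_iff _ _ _ _ _).2 fun h' _ => ?_
    obtain ⟨n', rfl⟩ := exists_eq_fAssignment h'
    rw [eval_gVars, headAt_hRule]
    simp only [exRank_gAtom, exRank_hAtom]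
    exact F_le_F.2 (Subtype.mk_le_mk.2 (gOrdinal_lt N _).le)
  · refine (Formula.eval_exs_le_iff _ _ _ _ _).2 fun h' hh' => ?_
    obtain ⟨n', rfl⟩ := exists_eq_fAssignment h'
    have hn : ∀ x ≤ (m : ℕ), n' x = n x := fun x hx =>
      fPow_injective (hh' x fun hmem => by simp at hmem; omega)
    rw [eval_gVars, headAt_limitRule]
    simp only [exRank_gAtom]
    refine F_le_F.2 (Subtype.mk_le_mk.2
      (gOrdinal_lt_of_isPremise (m := m) ⟨fun i hi => ?_, ?_, fun i hi => ?_⟩).le)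
    · have hi : (i : ℕ) < m := hi
      rw [if_pos hi, hn i hi.le]
    · simp only [Fin.val_castSucc, lt_irrefl, if_false, if_true, hn m le_rfl]
    · have hi : (m : ℕ) < i := hi
      rw [if_neg hi.not_gt, if_neg hi.ne']

theorem isRanked_exProgram (N : ℕ) : (exProgram N).IsRanked (exRank N) where
  monotone := monotone_consequence_exProgram
  consequence_le := consequence_exRank_le
  cases A := by
    rcases eq_gAtom_or_eq_hAtom A with ⟨k, rfl⟩ | rfl
    · by_cases hk : ∃ i, k i ≠ 0
      · refine Or.inr ?_
        -- The last nonzero entry decides which rule applies.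
        obtain ⟨j, hj⟩ : ∃ j, Maximal (fun i => k i ≠ 0) j :=
          (Set.toFinite {i | k i ≠ 0}).exists_maximal hk
        have hj0 : ∀ i > j, k i = 0 := fun i hi => not_not.1 fun h => hj.not_prop_of_gt hi h
        induction j using Fin.lastCases with
        | last => exact Or.inl (followsFromNegNeg_gAtom (Nat.pos_of_ne_zero hj.prop))
        | cast m =>
          refine Or.inr fun z hz => ?_
          rw [exRank_gAtom] at hz
          obtain ⟨k', hp, hk', hz'⟩ := exists_isPremise_lt_gOrdinal hj.prop hj0
            (Subtype.coe_lt_coe.2 hz)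
          refine ⟨gAtom N k', ?_, le_consequence_gAtom hp, followsFromNegNeg_gAtom hk'⟩
          rw [exRank_gAtom]
          exact hz'
      · refine Or.inl ?_
        rw [exRank_gAtom]
        exact gOrdinal_eq_zero fun i => not_not.1 fun h => hk ⟨i, h⟩
    · refine Or.inr (Or.inr fun z hz => ?_)
      rw [exRank_hAtom] at hz
      obtain ⟨k, hk, hz'⟩ := exists_lt_gOrdinal (Subtype.coe_lt_coe.2 hz)
      refine ⟨gAtom N k, ?_, le_consequence_hAtom k, followsFromNegNeg_gAtom hk⟩
      rw [exRank_gAtom]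
      exact hz'

theorem lt_depth_exProgram (N : ℕ) : ω ^ (N + 1) < (exProgram N).depth.1 := by
  have h := (isRanked_exProgram N).rank_lt_depth (add_one_lt_omega_one (omega_pow_lt_omega_one _))
    exRank_lt (hAtom N)
  rwa [exRank_hAtom] at h

/-! ### There are only countably many programs -/

instance : Countable Signature := by
  let code (L : Signature) : Σ p : ℕ × ℕ × ℕ, (Fin p.1 → ℕ) × (Fin p.2.1 → ℕ) :=
    ⟨(L.numPred, L.numFun, L.numConst), L.predArity, L.funArity⟩
  refine Function.Injective.countable (f := code) ?_
  rintro ⟨a, b, c, p, f, _, _, _⟩ ⟨a', b', c', p', f', _, _, _⟩ h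
  simp only [code, Sigma.mk.injEq, Prod.mk.injEq] at h
  obtain ⟨⟨rfl, rfl, rfl⟩, h⟩ := h
  obtain ⟨rfl, rfl⟩ := Prod.mk.inj (eq_of_heq h)
  rfl

/-- A numbering of the terms. -/
def Term.code : Term L ℕ → ℕ
  | var x => Encodable.encode (0, x, ([] : List ℕ))
  | const c => Encodable.encode (1, (c : ℕ), ([] : List ℕ))
  | func i ts => Encodable.encode (2, (i : ℕ), List.ofFn fun j => (ts j).code)

theorem Term.code_injective : Function.Injective (Term.code (L := L)) := by
  intro t
  induction t with
  | var x => rintro (_ | _ | _) h <;> simp_all [code]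
  | const c => rintro (_ | _ | _) h <;> simp_all [code, Fin.ext_iff]
  | func i ts ih =>
    rintro (_ | _ | ⟨i', ts'⟩) h <;> simp only [code, Encodable.encode_inj, Prod.mk.injEq] at h
    · simp at h
    · simp at h
    · obtain ⟨-, hi, h⟩ := h
      obtain rfl := Fin.ext hi
      exact congrArg _ (funext fun j => ih j (congrFun (List.ofFn_injective h) j))

instance : Countable (Term L ℕ) := Term.code_injective.countable

/-- A numbering of the formulas. -/
def Formula.code : Formula L → ℕ
  | bot => Encodable.encode (0, 0, ([] : List ℕ))
  | top => Encodable.encode (1, 0, ([] : List ℕ))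
  | pred k ts => Encodable.encode (2, (k : ℕ), List.ofFn fun j => (ts j).code)
  | neg p => Encodable.encode (3, 0, [p.code])
  | and p q => Encodable.encode (4, 0, [p.code, q.code])
  | or p q => Encodable.encode (5, 0, [p.code, q.code])
  | all v p => Encodable.encode (6, v, [p.code])
  | ex v p => Encodable.encode (7, v, [p.code])

theorem Formula.code_injective : Function.Injective (Formula.code (L := L)) := by
  intro p
  induction p with
  | pred k ts =>
    intro q h
    cases q <;> simp only [code, Encodable.encode_inj, Prod.mk.injEq] at h
    case pred k' ts' =>
      obtain ⟨-, hk, h⟩ := h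
      obtain rfl := Fin.ext hk
      exact congrArg _ (funext fun j => Term.code_injective (congrFun (List.ofFn_injective h) j))
    all_goals simp at h
  | bot => intro q h; cases q <;> simp_all [code]
  | top => intro q h; cases q <;> simp_all [code]
  | neg p hp =>
    intro q h
    cases q <;> simp [code] at h
    rw [hp h]
  | and p p' hp hp' =>
    intro q h
    cases q <;> simp [code] at h
    rw [hp h.1, hp' h.2]
  | or p p' hp hp' =>
    intro q h
    cases q <;> simp [code] at h
    rw [hp h.1, hp' h.2]
  | all v p hp =>
    intro q h
    cases q <;> simp [code] at h
    rw [h.1, hp h.2]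
  | ex v p hp =>
    intro q h
    cases q <;> simp [code] at h
    rw [h.1, hp h.2]

instance : Countable (Formula L) := Formula.code_injective.countable

instance : Countable (Rule L) := by
  let parts (r : Rule L) : (Σ k : Fin L.numPred, Fin (L.predArity k) → Term L ℕ) × Formula L :=
    (⟨r.pred, r.args⟩, r.body)
  refine Function.Injective.countable (f := parts) ?_
  rintro ⟨k, as, p⟩ ⟨k', as', p'⟩ h
  simp only [parts, Prod.mk.injEq, Sigma.mk.injEq] at h
  obtain ⟨⟨rfl, h⟩, rfl⟩ := h
  rw [eq_of_heq h]

instance : Countable (Program L) := by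
  have : Countable {s : Set (Rule L) | s.Finite} := Set.Countable.ofPred_finite
  refine Function.Injective.countable
    (f := fun P : Program L => (⟨P.rules, P.finite⟩ : {s : Set (Rule L) | s.Finite})) ?_
  rintro ⟨r, _⟩ ⟨r', _⟩ h
  obtain rfl : r = r' := congrArg Subtype.val h
  rfl

/-- The set whose infimum is `deltaMax` is not empty; otherwise the infimum would be `0`. -/
theorem exists_depth_lt :
    ∃ d : Ordinal.{0}, d < ω₁ ∧ ∀ (L : Signature) (P : Program L), P.depth.1 < d := by
  let D (x : Σ L : Signature, Program L) : Ordinal.{0} := x.2.depth.1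
  exact ⟨(⨆ x, D x) + 1, add_one_lt_omega_one (Ordinal.iSup_lt_omega_one fun x => x.2.depth.2),
    fun L P => Order.lt_add_one_iff.2 (Ordinal.le_iSup D ⟨L, P⟩)⟩

theorem omega_opow_omega_le_deltaMax : ω ^ ω ≤ deltaMax := by
  refine le_csInf exists_depth_lt fun d hd => ?_
  rw [Ordinal.opow_le_of_isSuccLimit Ordinal.omega0_ne_zero Ordinal.isSuccLimit_omega0]
  intro b hb
  obtain ⟨n, rfl⟩ := Ordinal.lt_omega0.1 hb
  rw [Ordinal.opow_natCast]
  refine le_trans ?_ ((lt_depth_exProgram n).trans (hd.2 _ _)).le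
  exact pow_le_pow_right₀ Ordinal.one_lt_omega0.le n.le_succ

end FormulaLP

theorem proposition4 :
    ω ^ ω ≤ FormulaLP.deltaMax ∧
    ∀ N : ℕ,
      (FormulaLP.exProgram N).model.IsLeastModel (FormulaLP.exProgram N) ∧
      (∃ h : ω ^ (N + 1) < ω₁,
        (FormulaLP.exProgram N).model (FormulaLP.hAtom N) = .F ⟨ω ^ (N + 1), h⟩) ∧
      (∀ k : Fin (N + 1) → ℕ, ∃ h : FormulaLP.gOrdinal N k < ω₁,
        (FormulaLP.exProgram N).model (FormulaLP.gAtom N k) = .F ⟨FormulaLP.gOrdinal N k, h⟩) ∧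
      ω ^ (N + 1) < (FormulaLP.exProgram N).depth.1 := by
  refine ⟨FormulaLP.omega_opow_omega_le_deltaMax, fun N => ?_⟩
  have hP := FormulaLP.isRanked_exProgram N
  rw [hP.model_eq (FormulaLP.add_one_lt_omega_one (FormulaLP.omega_pow_lt_omega_one _))
    FormulaLP.exRank_lt]
  exact ⟨hP.isLeastModel,
    ⟨FormulaLP.omega_pow_lt_omega_one _, congrArg _ FormulaLP.exRank_hAtom⟩,
    fun k => ⟨FormulaLP.gOrdinal_lt_omega_one k, congrArg _ (FormulaLP.exRank_gAtom k)⟩,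
    FormulaLP.lt_depth_exProgram N⟩
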